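/- Let $R=[r^1,\dots,r^k]\in\mathbb{Q}^{2\times k}$ have nonzero columns with $\operatorname{cone}\{r^1,\dots,r^k\}=\mathbb{R}^2$, let $f\in\mathbb{Q}^2\setminus\mathbb{Z}^2$, and let $$P(R,f)=\{(x,s)\in\mathbb{Z}^2\times\mathbb{R}^k_+ : x=f+Rs\},\qquad P(R,f)^0=\{(x,s)\in\mathbb{R}^2\times\mathbb{R}^k_+ : x=f+Rs\}.$$ For a set $Q\subseteq\mathbb{R}^2\times\mathbb{R}^k$, its split closure is the intersection, over all $\pi\in\mathbb{Z}^2$ and $\pi_0\in\mathbb{Z}$, of the sets $$\operatorname{conv}\bigl((Q\cap\{\pi^Tx\le\pi_0\})\cup(Q\cap\{\pi^Tx\ge\pi_0+1\})\bigr).$$ Starting from $Q^0=P(R,f)^0$, let $Q^{n+1}$ be the split closure of $Q^n$. The split rank of an inequality (with respect to $P(R,f)^0$) is the smallest $n\ge 0$ such that the inequality is valid for $Q^n$, and $+\infty$ if there is no such $n$. Let $\alpha\in\mathbb{R}^k_+$ be such that $\sum_{i=1}^k\alpha_is_i\ge 1$ is valid for $\operatorname{conv}(P(R,f))$, and let $$L_\alpha=\operatorname{conv}\Bigl(\{f\}\cup\bigl\{f+\tfrac{1}{\alpha_i}r^i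 : \alpha_i>0\bigr\}\Bigr)+\operatorname{cone}\{r^i:\alpha_i=0\}$$ be its induced lattice-free set. A triangle of type $T^{2B}$ is a (nondegenerate) triangle whose interior contains no point of $\mathbb{Z}^2$ and which has a vertex $v\notin\mathbb{Z}^2$ such that the side opposite to $v$ contains at least two integer points (possibly end points), one of the two sides incident to $v$ contains exactly one integer point in its relative interior, and the other side incident to $v$ contains no integer point in its relative interior. **Proposition.** If $L_\alpha$ is a triangle of type $T^{2B}$, then the split rank of $\sum_{i=1}^k\alpha_is_i\ge 1$ with respect to $P(R,f)^0$ is finite. -/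

import Mathlib

open scoped Matrix Pointwise

noncomputable section

/-! ### Valid inequalities, split closures and split rank

A point of `ℝ^p × ℝ^q` is a pair `z = (x, y)`; the integer variables are the coordinates of `x`. -/

/-- The inequality `aᵀ x + bᵀ y ≤ γ` is valid for the set `S ⊆ ℝ^p × ℝ^q`. -/
def IsValidIneq {p q : ℕ} (a : Fin p → ℝ) (b : Fin q → ℝ) (γ : ℝ)
    (S : Set ((Fin p → ℝ) × (Fin q → ℝ))) : Prop :=
  ∀ z ∈ S, a ⬝ᵥ z.1 + b ⬝ᵥ z.2 ≤ γ

/-- The convex hull of the two parts of `Q` that are cut out by the split disjunction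
`πᵀ x ≤ π₀` or `πᵀ x ≥ π₀ + 1`. -/
def splitHull {p q : ℕ} (Q : Set ((Fin p → ℝ) × (Fin q → ℝ))) (π : Fin p → ℤ) (π₀ : ℤ) :
    Set ((Fin p → ℝ) × (Fin q → ℝ)) :=
  convexHull ℝ
    ((Q ∩ {z | (fun i => (π i : ℝ)) ⬝ᵥ z.1 ≤ (π₀ : ℝ)}) ∪
     (Q ∩ {z | (π₀ : ℝ) + 1 ≤ (fun i => (π i : ℝ)) ⬝ᵥ z.1}))

/-- The first split closure of `Q`: the intersection over all split disjunctions. -/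
def splitClosure {p q : ℕ} (Q : Set ((Fin p → ℝ) × (Fin q → ℝ))) :
    Set ((Fin p → ℝ) × (Fin q → ℝ)) :=
  ⋂ (π : Fin p → ℤ) (π₀ : ℤ), splitHull Q π π₀

/-- The `n`-th split closure of `Q`; the `0`-th one is `Q` itself. -/
def iterSplitClosure {p q : ℕ} (Q : Set ((Fin p → ℝ) × (Fin q → ℝ))) :
    ℕ → Set ((Fin p → ℝ) × (Fin q → ℝ))
  | 0 => Q
  | n + 1 => splitClosure (iterSplitClosure Q n)

/-- The split rank of `aᵀ x + bᵀ y ≤ γ` with respect to `Q`: the least `n` such that the inequality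
is valid for the `n`-th split closure of `Q`, and `⊤` if there is no such `n`. -/
def splitRank {p q : ℕ} (Q : Set ((Fin p → ℝ) × (Fin q → ℝ)))
    (a : Fin p → ℝ) (b : Fin q → ℝ) (γ : ℝ) : ℕ∞ :=
  ⨅ (n : ℕ) (_ : IsValidIneq a b γ (iterSplitClosure Q n)), (n : ℕ∞)

/-! ### The two-row set -/

/-- The integer lattice `ℤ²` in the plane. -/
def latticePoints : Set (Fin 2 → ℝ) :=
  {x | ∃ z : Fin 2 → ℤ, ∀ i, x i = (z i : ℝ)}

/-- The base point `f`, as a real vector. -/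
def realPoint (f : Fin 2 → ℚ) : Fin 2 → ℝ := fun j => (f j : ℝ)

/-- The `i`-th column `r^i` of `R`, as a real vector. -/
def ray {k : ℕ} (R : Matrix (Fin 2) (Fin k) ℚ) (i : Fin k) : Fin 2 → ℝ := fun j => (R j i : ℝ)

/-- The linear relaxation `P(R,f)⁰`: all `(x, s)` with `x = f + R s` and `s ≥ 0`. -/
def linearRelaxation {k : ℕ} (R : Matrix (Fin 2) (Fin k) ℚ) (f : Fin 2 → ℚ) :
    Set ((Fin 2 → ℝ) × (Fin k → ℝ)) :=
  {z | z.1 = realPoint f + ∑ i, z.2 i • ray R i ∧ ∀ i, 0 ≤ z.2 i}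

/-- The mixed integer set `P(R,f)`: the points `(x, s)` of the linear relaxation with `x ∈ ℤ²`. -/
def mixedIntegerSet {k : ℕ} (R : Matrix (Fin 2) (Fin k) ℚ) (f : Fin 2 → ℚ) :
    Set ((Fin 2 → ℝ) × (Fin k → ℝ)) :=
  {z | z ∈ linearRelaxation R f ∧ z.1 ∈ latticePoints}

/-- The set `L_α` induced by the inequality `∑ α_i s_i ≥ 1`: the convex hull of `f` and of the
points `f + r^i / α_i` with `α_i > 0`, plus the cone generated by the `r^i` with `α_i = 0`. -/
def inducedSet {k : ℕ} (R : Matrix (Fin 2) (Fin k) ℚ) (f : Fin 2 → ℚ) (α : Fin k → ℝ) :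
    Set (Fin 2 → ℝ) :=
  convexHull ℝ
      ({x | ∃ i, 0 < α i ∧ x = realPoint f + (α i)⁻¹ • ray R i} ∪ {realPoint f}) +
    (PointedCone.hull ℝ {x | ∃ i, α i = 0 ∧ x = ray R i} : Set (Fin 2 → ℝ))

/-- A set in the plane is lattice-free if its interior contains no integer point. -/
def IsLatticeFree (S : Set (Fin 2 → ℝ)) : Prop :=
  interior S ∩ latticePoints = ∅

/-- Lattice-free triangles of type `T^{2B}`: the vertex `v` is not integral, the opposite side `uw`
contains at least two integer points (end points are allowed), the side `uv` contains exactly one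
integer point in its relative interior, and the side `vw` contains none in its relative interior. -/
def IsTypeT2B (L : Set (Fin 2 → ℝ)) : Prop :=
  ∃ u v w : Fin 2 → ℝ,
    AffineIndependent ℝ ![u, v, w] ∧
    L = convexHull ℝ {u, v, w} ∧
    IsLatticeFree L ∧
    v ∉ latticePoints ∧
    (segment ℝ u w ∩ latticePoints).Nontrivial ∧
    (∃! p, p ∈ openSegment ℝ u v ∩ latticePoints) ∧
    openSegment ℝ v w ∩ latticePoints = ∅

end

/-!
Let `q` be the integer point inside the side `uv`, and `uw` the side opposite to the nonintegral
vertex `v`. Emptiness of the triangle provides integral affine forms `X` and `Y` in which `q` is the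
origin, the side `uw` lies on `Y = -1`, and `(1, 0)` lies beyond the side `vw`. The vertex `u` is
one of the points `f + r^i / α_i`, so it is rational and the line `uv`, `X = a Y`, has a rational
slope.

Each side of the triangle gives a lower bound on `∑ α_i s_i` that is affine in `x`. Suppose that
`1 - ε ≤ ∑ α_i s_i` is already valid. A split along the side `uv` tilts this inequality about that
side, a split on `X` turns the result into `1 - ε' + K Y ≤ ∑ α_i s_i` with `ε' = max 0 (ε - β)`,
and a split on `Y` removes the term `K Y`, because `1 ≤ ∑ α_i s_i` holds where `Y ≤ -1`. As `β`
does not depend on `ε`, finitely many rounds suffice.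
-/

section IntegralForms

variable {p : ℕ}

/-- The affine form `x ↦ πᵀ x + c` with integer coefficients. -/
def integralForm (π : Fin p → ℤ) (c : ℤ) : (Fin p → ℝ) →ᵃ[ℝ] ℝ :=
  (dotProductBilin ℝ ℝ fun i => (π i : ℝ)).toAffineMap + AffineMap.const ℝ _ (c : ℝ)

@[simp]
lemma integralForm_apply (π : Fin p → ℤ) (c : ℤ) (x : Fin p → ℝ) :
    integralForm π c x = (fun i => (π i : ℝ)) ⬝ᵥ x + c :=
  rfl

/-- The group of affine forms with integer coefficients. Its members `φ` are the ones that give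
split disjunctions `φ ≤ 0 ∨ 1 ≤ φ`. -/
def integralForms (p : ℕ) : AddSubgroup ((Fin p → ℝ) →ᵃ[ℝ] ℝ) where
  carrier := {φ | ∃ π c, φ = integralForm π c}
  zero_mem' := ⟨0, 0, by ext x; simp [dotProduct]⟩
  add_mem' := by
    rintro _ _ ⟨π, c, rfl⟩ ⟨π', c', rfl⟩
    refine ⟨π + π', c + c', ?_⟩
    ext x
    simp only [AffineMap.coe_add, Pi.add_apply, integralForm_apply, dotProduct, Int.cast_add,
      add_mul, Finset.sum_add_distrib]
    ring
  neg_mem' := by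
    rintro _ ⟨π, c, rfl⟩
    refine ⟨-π, -c, ?_⟩
    ext x
    simp only [AffineMap.coe_neg, Pi.neg_apply, integralForm_apply, dotProduct, Int.cast_neg,
      neg_mul, Finset.sum_neg_distrib]
    ring

lemma integralForm_mem (π : Fin p → ℤ) (c : ℤ) : integralForm π c ∈ integralForms p :=
  ⟨π, c, rfl⟩

end IntegralForms

section SplitClosure

variable {p q : ℕ} {Q H : Set ((Fin p → ℝ) × (Fin q → ℝ))} {φ : (Fin p → ℝ) →ᵃ[ℝ] ℝ}

lemma splitClosure_subset_of_convex (hH : Convex ℝ H) (hφ : φ ∈ integralForms p)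
    (h₀ : ∀ z ∈ Q, φ z.1 ≤ 0 → z ∈ H) (h₁ : ∀ z ∈ Q, 1 ≤ φ z.1 → z ∈ H) :
    splitClosure Q ⊆ H := by
  obtain ⟨π, c, rfl⟩ := hφ
  refine (Set.iInter₂_subset π (-c)).trans (convexHull_min ?_ hH)
  rintro z (⟨hz, hle⟩ | ⟨hz, hge⟩)
  · refine h₀ z hz ?_
    simp only [Set.mem_ofPred_eq, Int.cast_neg] at hle
    rw [integralForm_apply]
    linarith
  · refine h₁ z hz ?_
    simp only [Set.mem_ofPred_eq, Int.cast_neg] at hge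
    rw [integralForm_apply]
    linarith

lemma convex_splitClosure (Q : Set ((Fin p → ℝ) × (Fin q → ℝ))) : Convex ℝ (splitClosure Q) :=
  convex_iInter₂ fun _ _ => convex_convexHull ℝ _

lemma splitClosure_subset (hQ : Convex ℝ Q) : splitClosure Q ⊆ Q :=
  splitClosure_subset_of_convex hQ (zero_mem _) (fun _ hz _ => hz) fun _ hz _ => hz

lemma convex_iterSplitClosure (hQ : Convex ℝ Q) : ∀ n, Convex ℝ (iterSplitClosure Q n)
  | 0 => hQ
  | _ + 1 => convex_splitClosure _

lemma iterSplitClosure_subset (hQ : Convex ℝ Q) (n : ℕ) : iterSplitClosure Q n ⊆ Q := by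
  induction n with
  | zero => exact subset_rfl
  | succ n ih => exact (splitClosure_subset (convex_iterSplitClosure hQ n)).trans ih

lemma splitRank_lt_top {a : Fin p → ℝ} {b : Fin q → ℝ} {γ : ℝ} {n : ℕ}
    (h : IsValidIneq a b γ (iterSplitClosure Q n)) : splitRank Q a b γ < ⊤ :=
  (iInf₂_le n h).trans_lt (ENat.natCast_lt_top n)

lemma convex_setOf_le_dotProduct (α : Fin q → ℝ) (ψ : (Fin p → ℝ) →ᵃ[ℝ] ℝ) :
    Convex ℝ {z : (Fin p → ℝ) × (Fin q → ℝ) | ψ z.1 ≤ α ⬝ᵥ z.2} := by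
  intro x hx y hy a b ha hb hab
  have hψ : ψ (a • x.1 + b • y.1) = a * ψ x.1 + b * ψ y.1 := Convex.combo_affine_apply hab
  simp only [Set.mem_ofPred_eq, Prod.fst_add, Prod.snd_add, Prod.smul_fst, Prod.smul_snd, hψ,
    dotProduct_add, dotProduct_smul, smul_eq_mul] at *
  gcongr

lemma le_dotProduct_of_mem_splitClosure {α : Fin q → ℝ} (hφ : φ ∈ integralForms p)
    (ψ : (Fin p → ℝ) →ᵃ[ℝ] ℝ) (h₀ : ∀ z ∈ Q, φ z.1 ≤ 0 → ψ z.1 ≤ α ⬝ᵥ z.2)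
    (h₁ : ∀ z ∈ Q, 1 ≤ φ z.1 → ψ z.1 ≤ α ⬝ᵥ z.2) :
    ∀ z ∈ splitClosure Q, ψ z.1 ≤ α ⬝ᵥ z.2 :=
  splitClosure_subset_of_convex (convex_setOf_le_dotProduct α ψ) hφ h₀ h₁

end SplitClosure

section ThreeSplits

variable {p q : ℕ} {P Q : Set ((Fin p → ℝ) × (Fin q → ℝ))} {X Y g : (Fin p → ℝ) →ᵃ[ℝ] ℝ}
  {α : Fin q → ℝ} {a n c B σ r K β ε ε' : ℝ}

lemma tilt_le_dotProduct_of_mem_splitClosure (hn : 0 < n) (hε : 0 ≤ ε)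
    (hg : n • g ∈ integralForms p) (hc : ∀ z ∈ Q, 1 - c * g z.1 ≤ α ⬝ᵥ z.2)
    (hQ : ∀ z ∈ Q, 1 - ε ≤ α ⬝ᵥ z.2) :
    ∀ z ∈ splitClosure Q, 1 - min c (ε * n) * g z.1 ≤ α ⬝ᵥ z.2 := by
  refine le_dotProduct_of_mem_splitClosure hg (AffineMap.const ℝ _ 1 - min c (ε * n) • g) ?_ ?_
  · intro z hz (hz₀ : n * g z.1 ≤ 0)
    have hmin : c * g z.1 ≤ min c (ε * n) * g z.1 :=
      mul_le_mul_of_nonpos_right (min_le_left _ _) (nonpos_of_mul_nonpos_right hz₀ hn)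
    exact (sub_le_sub_left hmin 1).trans (hc z hz)
  · intro z hz (hz₁ : 1 ≤ n * g z.1)
    change 1 - min c (ε * n) * g z.1 ≤ α ⬝ᵥ z.2
    rcases min_choice c (ε * n) with h | h <;> rw [h]
    · exact hc z hz
    · linarith [hQ z hz, mul_le_mul_of_nonneg_left hz₁ hε]

lemma one_sub_add_mul_le_dotProduct_of_mem_splitClosure (hX : X ∈ integralForms p)
    (hεβ : ε - β ≤ ε') (hQ : ∀ z ∈ Q, 1 - ε ≤ α ⬝ᵥ z.2)
    (h₀ : ∀ z ∈ Q, X z.1 ≤ 0 → -β ≤ K * Y z.1 → 1 - ε' + K * Y z.1 ≤ α ⬝ᵥ z.2)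
    (h₁ : ∀ z ∈ Q, 1 ≤ X z.1 → -β ≤ K * Y z.1 → 1 - ε' + K * Y z.1 ≤ α ⬝ᵥ z.2) :
    ∀ z ∈ splitClosure Q, 1 - ε' + K * Y z.1 ≤ α ⬝ᵥ z.2 := by
  have hlow : ∀ z ∈ Q, K * Y z.1 ≤ -β → 1 - ε' + K * Y z.1 ≤ α ⬝ᵥ z.2 := fun z hz hβ => by
    linarith [hQ z hz]
  refine le_dotProduct_of_mem_splitClosure hX (AffineMap.const ℝ _ (1 - ε') + K • Y) ?_ ?_
  · exact fun z hz hz₀ => (le_total (-β) (K * Y z.1)).elim (h₀ z hz hz₀) (hlow z hz)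
  · exact fun z hz hz₁ => (le_total (-β) (K * Y z.1)).elim (h₁ z hz hz₁) (hlow z hz)

lemma one_sub_le_dotProduct_of_mem_splitClosure (hY : Y ∈ integralForms p) (hK : 0 ≤ K)
    (hε' : 0 ≤ ε') (hbase : ∀ z ∈ Q, Y z.1 ≤ -1 → 1 ≤ α ⬝ᵥ z.2)
    (hQ : ∀ z ∈ Q, 1 - ε' + K * Y z.1 ≤ α ⬝ᵥ z.2) :
    ∀ z ∈ splitClosure Q, 1 - ε' ≤ α ⬝ᵥ z.2 := by
  refine le_dotProduct_of_mem_splitClosure (neg_mem hY) (AffineMap.const ℝ _ (1 - ε')) ?_ ?_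
  · intro z hz (hz₀ : -Y z.1 ≤ 0)
    change 1 - ε' ≤ α ⬝ᵥ z.2
    linarith [hQ z hz, mul_nonneg hK (neg_nonpos.1 hz₀)]
  · intro z hz (hz₁ : 1 ≤ -Y z.1)
    change 1 - ε' ≤ α ⬝ᵥ z.2
    linarith [hbase z hz (by linarith)]

/-- To the left of the line `x = 0`, the bounds `1 - c (x - a y)` and `1 - min c (ε n) (x - a y)`
beat `1 - ε' + K y`: the first one where `0 ≤ y`, the second one where `-β ≤ K y ≤ 0`. -/
lemma one_sub_add_mul_le_of_nonpos {x y T : ℝ} (ha : 0 ≤ a) (hn : 0 ≤ n) (hc : 0 ≤ c) (hβ : 0 < β)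
    (hε : 0 ≤ ε) (hε' : 0 ≤ ε') (hεβ : ε - β ≤ ε') (hKc : K ≤ c * a) (hKn : n * a * β ≤ K)
    (hx : x ≤ 0) (hy : -β ≤ K * y) (hT : 1 - c * (x - a * y) ≤ T)
    (hT' : 1 - min c (ε * n) * (x - a * y) ≤ T) : 1 - ε' + K * y ≤ T := by
  rcases le_total 0 y with hy₀ | hy₀
  · linarith [mul_nonpos_of_nonneg_of_nonpos hc hx, mul_le_mul_of_nonneg_right hKc hy₀]
  have hmin : 0 ≤ min c (ε * n) := le_min hc (by positivity)
  have hslope : ε * n * (a * y) ≤ min c (ε * n) * (a * y) :=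
    mul_le_mul_of_nonpos_right (min_le_right _ _) (mul_nonpos_of_nonneg_of_nonpos ha hy₀)
  have hscale : β * (n * a * y) ≥ K * y := by
    linarith [mul_le_mul_of_nonpos_right hKn hy₀]
  have hunit : -1 ≤ n * a * y := by
    refine le_of_mul_le_mul_left ?_ hβ
    linarith
  have hcombine : -(ε' * 1) + K * y ≤ ε * n * (a * y) := by
    have hnay : n * a * y ≤ 0 := mul_nonpos_of_nonneg_of_nonpos (by positivity) hy₀
    linarith [mul_le_mul_of_nonneg_left hunit hε', mul_le_mul_of_nonpos_right hεβ hnay]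
  linarith [mul_nonpos_of_nonneg_of_nonpos hmin hx]

lemma one_add_mul_le_of_le_mul {y T : ℝ} (hK : 0 < K) (hKB : K ≤ B) (hβ : |r| * β ≤ σ * K)
    (hy : -β ≤ K * y) (hT : 1 + B * y ≤ T) (hT' : 1 + σ + r * y ≤ T) : 1 + K * y ≤ T := by
  rcases le_total 0 y with hy₀ | hy₀
  · linarith [mul_le_mul_of_nonneg_right hKB hy₀]
  have hr : -(r * y) ≤ |r| * -y := by
    rw [← mul_neg]
    exact mul_le_mul_of_nonneg_right (le_abs_self r) (by linarith)
  have hσ : |r| * -y ≤ σ := by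
    refine le_of_mul_le_mul_right ?_ hK
    linarith [mul_le_mul_of_nonneg_left hy (abs_nonneg r)]
  linarith [mul_nonpos_of_nonneg_of_nonpos hK.le hy₀]

/-- One round of three splits, along `X - a Y`, `X` and `Y`. -/
lemma one_sub_le_dotProduct_of_mem_splitClosure₃ (hX : X ∈ integralForms p)
    (hY : Y ∈ integralForms p) (hXY : n • (X - a • Y) ∈ integralForms p) (ha : 0 ≤ a) (hn : 0 < n)
    (hc : 0 ≤ c) (hK : 0 < K) (hKc : K ≤ c * a) (hKB : K ≤ B) (hβ : 0 < β) (hKn : n * a * β ≤ K)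
    (hβσ : |r| * β ≤ σ * K) (hQ : Convex ℝ Q)
    (hbase : ∀ z ∈ Q, Y z.1 ≤ -1 → 1 ≤ α ⬝ᵥ z.2)
    (hleft : ∀ z ∈ Q, 1 - c * (X z.1 - a * Y z.1) ≤ α ⬝ᵥ z.2)
    (hapex : ∀ z ∈ Q, 1 ≤ X z.1 → 1 + B * Y z.1 ≤ α ⬝ᵥ z.2)
    (hright : ∀ z ∈ Q, 1 ≤ X z.1 → 1 + σ + r * Y z.1 ≤ α ⬝ᵥ z.2)
    (hε : 0 ≤ ε) (hlow : ∀ z ∈ Q, 1 - ε ≤ α ⬝ᵥ z.2) :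
    ∀ z ∈ splitClosure (splitClosure (splitClosure Q)), 1 - max 0 (ε - β) ≤ α ⬝ᵥ z.2 := by
  have hQ₁ : splitClosure Q ⊆ Q := splitClosure_subset hQ
  have hQ₂ : splitClosure (splitClosure Q) ⊆ Q :=
    (splitClosure_subset (convex_splitClosure Q)).trans hQ₁
  have htilt := tilt_le_dotProduct_of_mem_splitClosure hn hε hXY hleft hlow
  refine one_sub_le_dotProduct_of_mem_splitClosure hY hK.le (le_max_left _ _)
    (fun z hz => hbase z (hQ₂ hz)) (one_sub_add_mul_le_dotProduct_of_mem_splitClosure hX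
      (le_max_right _ _) (fun z hz => hlow z (hQ₁ hz)) ?_ ?_)
  · exact fun z hz hx hy => one_sub_add_mul_le_of_nonpos ha hn.le hc hβ hε (le_max_left _ _)
      (le_max_right _ _) hKc hKn hx hy (hleft z (hQ₁ hz)) (htilt z hz)
  · intro z hz hx hy
    linarith [le_max_left 0 (ε - β), one_add_mul_le_of_le_mul hK hKB hβσ hy
      (hapex z (hQ₁ hz) hx) (hright z (hQ₁ hz) hx)]

theorem exists_iterSplitClosure_one_le_dotProduct (hX : X ∈ integralForms p)
    (hY : Y ∈ integralForms p) (hXY : n • (X - a • Y) ∈ integralForms p) (ha : 0 < a) (hn : 0 < n)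
    (hc : 0 < c) (hB : 0 < B) (hσ : 0 < σ) (hP : Convex ℝ P) (hnonneg : ∀ z ∈ P, 0 ≤ α ⬝ᵥ z.2)
    (hbase : ∀ z ∈ P, Y z.1 ≤ -1 → 1 ≤ α ⬝ᵥ z.2)
    (hleft : ∀ z ∈ P, 1 - c * (X z.1 - a * Y z.1) ≤ α ⬝ᵥ z.2)
    (hapex : ∀ z ∈ P, 1 ≤ X z.1 → 1 + B * Y z.1 ≤ α ⬝ᵥ z.2)
    (hright : ∀ z ∈ P, 1 ≤ X z.1 → 1 + σ + r * Y z.1 ≤ α ⬝ᵥ z.2) :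
    ∃ N, ∀ z ∈ iterSplitClosure P N, 1 ≤ α ⬝ᵥ z.2 := by
  obtain ⟨K, hK, hKc, hKB⟩ : ∃ K, 0 < K ∧ K ≤ c * a ∧ K ≤ B :=
    ⟨min (c * a) B, by positivity, min_le_left _ _, min_le_right _ _⟩
  obtain ⟨β, hβ, hKn, hβσ⟩ : ∃ β, 0 < β ∧ n * a * β ≤ K ∧ |r| * β ≤ σ * K := by
    refine ⟨min (K / (n * a)) (σ * K / (|r| + 1)), by positivity, ?_, ?_⟩
    · exact (le_div_iff₀' (by positivity)).1 (min_le_left _ _)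
    · have hr := (le_div_iff₀' (by positivity)).1 (min_le_right (K / (n * a)) (σ * K / (|r| + 1)))
      refine le_trans ?_ hr
      gcongr
      linarith
  have hround : ∀ m : ℕ, ∃ N, ∀ z ∈ iterSplitClosure P N, 1 - max 0 (1 - m * β) ≤ α ⬝ᵥ z.2 := by
    intro m
    induction m with
    | zero => exact ⟨0, fun z hz => by simpa using hnonneg z hz⟩
    | succ m ih =>
      obtain ⟨N, hN⟩ := ih
      have hNP := iterSplitClosure_subset hP N
      refine ⟨N + 3, fun z hz => ?_⟩
      have hlift := one_sub_le_dotProduct_of_mem_splitClosure₃ hX hY hXY ha.le hn hc.le hK hKc hKB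
        hβ hKn hβσ (convex_iterSplitClosure hP N) (fun z hz => hbase z (hNP hz))
        (fun z hz => hleft z (hNP hz)) (fun z hz => hapex z (hNP hz))
        (fun z hz => hright z (hNP hz)) (le_max_left _ _) hN z hz
      have hmax : max 0 (max 0 (1 - m * β) - β) ≤ max 0 (1 - (m + 1 : ℕ) * β) := by
        push_cast
        grind
      linarith
  obtain ⟨m, hm⟩ := exists_nat_gt (1 / β)
  obtain ⟨N, hN⟩ := hround m
  rw [div_lt_iff₀ hβ] at hm
  rw [max_eq_left (by linarith), sub_zero] at hN
  exact ⟨N, hN⟩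

end ThreeSplits

section InducedSet

variable {k : ℕ} {R : Matrix (Fin 2) (Fin k) ℚ} {f : Fin 2 → ℚ} {α : Fin k → ℝ}
  {φ : (Fin 2 → ℝ) →ᵃ[ℝ] ℝ}

lemma affineMap_add_smul {V : Type*} [AddCommGroup V] [Module ℝ V] (φ : V →ᵃ[ℝ] ℝ) (x v : V)
    (s : ℝ) : φ (x + s • v) = φ x + s * φ.linear v := by
  rw [add_comm x, ← vadd_eq_add, φ.map_vadd, map_smul, vadd_eq_add, smul_eq_mul, add_comm]

lemma nonneg_of_mem_hull {E : Type*} [AddCommGroup E] [Module ℝ E] {S : Set E} {l : E →ₗ[ℝ] ℝ}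
    (h : ∀ x ∈ S, 0 ≤ l x) {y : E} (hy : y ∈ PointedCone.hull ℝ S) : 0 ≤ l y :=
  (Submodule.span_le (p := (PointedCone.positive ℝ ℝ).comap l)).2 h hy

lemma convex_linearRelaxation (R : Matrix (Fin 2) (Fin k) ℚ) (f : Fin 2 → ℚ) :
    Convex ℝ (linearRelaxation R f) := by
  rintro x ⟨hx, hx₀⟩ y ⟨hy, hy₀⟩ a b ha hb hab
  refine ⟨?_, fun i => add_nonneg (mul_nonneg ha (hx₀ i)) (mul_nonneg hb (hy₀ i))⟩
  simp only [Prod.fst_add, Prod.snd_add, Prod.smul_fst, Prod.smul_snd, Pi.add_apply, Pi.smul_apply,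
    smul_eq_mul, hx, hy, add_smul, mul_smul, Finset.sum_add_distrib, ← Finset.smul_sum, smul_add]
  rw [add_add_add_comm, ← add_smul, hab, one_smul]

lemma mem_inducedSet_of_generator {x : Fin 2 → ℝ}
    (hx : x ∈ {x | ∃ i, 0 < α i ∧ x = realPoint f + (α i)⁻¹ • ray R i} ∪ {realPoint f}) :
    x ∈ inducedSet R f α :=
  Set.mem_add.2 ⟨x, subset_convexHull ℝ _ hx, 0, Submodule.zero_mem _, add_zero x⟩

lemma realPoint_mem_inducedSet : realPoint f ∈ inducedSet R f α :=
  mem_inducedSet_of_generator (Or.inr rfl)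

lemma realPoint_add_inv_smul_ray_mem_inducedSet {i : Fin k} (hi : 0 < α i) :
    realPoint f + (α i)⁻¹ • ray R i ∈ inducedSet R f α :=
  mem_inducedSet_of_generator (Or.inl ⟨i, hi, rfl⟩)

lemma realPoint_add_smul_ray_mem_inducedSet {i : Fin k} (hi : α i = 0) {s : ℝ} (hs : 0 ≤ s) :
    realPoint f + s • ray R i ∈ inducedSet R f α :=
  Set.mem_add.2 ⟨_, subset_convexHull ℝ _ (Or.inr rfl), _,
    Submodule.smul_mem _ (⟨s, hs⟩ : {c : ℝ // 0 ≤ c}) (Submodule.subset_span ⟨i, hi, rfl⟩), rfl⟩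

lemma neg_mul_le_linear_ray {i : Fin k} (hα : 0 ≤ α i) (hφ : ∀ x ∈ inducedSet R f α, 0 ≤ φ x) :
    -(α i * φ (realPoint f)) ≤ φ.linear (ray R i) := by
  rcases hα.eq_or_lt with h | h
  · rw [← h, zero_mul, neg_zero]
    by_contra! hneg
    have hf := hφ _ (realPoint_mem_inducedSet (R := R) (f := f) (α := α))
    have hs : 0 ≤ (φ (realPoint f) + 1) / -φ.linear (ray R i) :=
      div_nonneg (by linarith) (by linarith)
    have hfar := hφ _ (realPoint_add_smul_ray_mem_inducedSet h.symm hs)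
    rw [affineMap_add_smul, div_neg, neg_mul, div_mul_cancel₀ _ hneg.ne] at hfar
    linarith
  · have hvertex := hφ _ (realPoint_add_inv_smul_ray_mem_inducedSet h)
    rw [affineMap_add_smul, inv_mul_eq_div, ← sub_neg_eq_add, sub_nonneg, ← neg_div,
      div_le_iff₀ h] at hvertex
    linarith

lemma pos_realPoint (hcone : PointedCone.hull ℝ (Set.range (ray R)) = ⊤) (hα : ∀ i, 0 ≤ α i)
    (hφ : ∀ x ∈ inducedSet R f α, 0 ≤ φ x) {x y : Fin 2 → ℝ} (hxy : φ x ≠ φ y) :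
    0 < φ (realPoint f) := by
  refine (hφ _ realPoint_mem_inducedSet).lt_of_ne' fun h₀ => hxy ?_
  have hnonneg (z : Fin 2 → ℝ) : 0 ≤ φ.linear z := by
    refine nonneg_of_mem_hull (S := Set.range (ray R)) ?_ (hcone ▸ Submodule.mem_top)
    rintro _ ⟨i, rfl⟩
    simpa only [h₀, mul_zero, neg_zero] using neg_mul_le_linear_ray (hα i) hφ
  have hzero : φ.linear (x - y) = 0 :=
    le_antisymm (by simpa using hnonneg (-(x - y))) (hnonneg _)
  rwa [← vsub_eq_sub, φ.linearMap_vsub, vsub_eq_sub, sub_eq_zero] at hzero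

lemma exists_pos_one_sub_mul_le (hcone : PointedCone.hull ℝ (Set.range (ray R)) = ⊤)
    (hα : ∀ i, 0 ≤ α i) (hφ : ∀ x ∈ inducedSet R f α, 0 ≤ φ x) {x y : Fin 2 → ℝ}
    (hxy : φ x ≠ φ y) :
    ∃ ω : ℝ, 0 < ω ∧ ∀ z ∈ linearRelaxation R f, 1 - ω * φ z.1 ≤ α ⬝ᵥ z.2 := by
  have hf := pos_realPoint hcone hα hφ hxy
  refine ⟨(φ (realPoint f))⁻¹, inv_pos.2 hf, ?_⟩
  rintro z ⟨hz, hs⟩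
  have hray : -(α ⬝ᵥ z.2 * φ (realPoint f)) ≤ ∑ i, z.2 i * φ.linear (ray R i) := by
    rw [dotProduct, Finset.sum_mul, ← Finset.sum_neg_distrib]
    refine Finset.sum_le_sum fun i _ => ?_
    linarith [mul_le_mul_of_nonneg_left (neg_mul_le_linear_ray (hα i) hφ) (hs i)]
  have hval : φ z.1 = φ (realPoint f) + ∑ i, z.2 i * φ.linear (ray R i) := by
    rw [hz, ← one_smul ℝ (∑ i, z.2 i • ray R i), affineMap_add_smul, one_mul, map_sum]
    simp only [map_smul, smul_eq_mul]
  rw [sub_le_iff_le_add, inv_mul_eq_div, ← sub_le_iff_le_add', le_div_iff₀ hf]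
  linarith

lemma exists_generator_eq_zero (hcone : PointedCone.hull ℝ (Set.range (ray R)) = ⊤)
    (hα : ∀ i, 0 ≤ α i) (hφ : ∀ x ∈ inducedSet R f α, 0 ≤ φ x) {u y : Fin 2 → ℝ}
    (hu : u ∈ inducedSet R f α) (hφu : φ u = 0) (hφy : φ y ≠ 0) :
    ∃ i, 0 < α i ∧ φ (realPoint f + (α i)⁻¹ • ray R i) = 0 := by
  by_contra! hne
  obtain ⟨x, hx, c, hc, rfl⟩ := Set.mem_add.1 hu
  have hx₀ : 0 < φ x := by
    refine convexHull_min ?_ ((convex_Ioi 0).affine_preimage φ) hx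
    rintro _ (⟨i, hi, rfl⟩ | rfl)
    · exact (hφ _ (realPoint_add_inv_smul_ray_mem_inducedSet hi)).lt_of_ne' (hne i hi)
    · exact pos_realPoint hcone hα hφ (hφu.trans_ne hφy.symm)
  have hc₀ : 0 ≤ φ.linear c := by
    refine nonneg_of_mem_hull ?_ hc
    rintro _ ⟨i, hi, rfl⟩
    simpa only [hi, zero_mul, neg_zero] using neg_mul_le_linear_ray (hα i) hφ
  rw [← one_smul ℝ c, affineMap_add_smul, one_mul] at hφu
  linarith

end InducedSet

section Rationality

variable {p : ℕ} {φ ψ : (Fin p → ℝ) →ᵃ[ℝ] ℝ}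

lemma exists_rat_eq_apply (hφ : φ ∈ integralForms p) (x : Fin p → ℚ) :
    ∃ y : ℚ, φ (fun i => (x i : ℝ)) = y := by
  obtain ⟨π, c, rfl⟩ := hφ
  exact ⟨∑ i, π i * x i + c, by simp [dotProduct]⟩

lemma exists_rat_eq_linear (hφ : φ ∈ integralForms p) (r : Fin p → ℚ) :
    ∃ y : ℚ, φ.linear (fun i => (r i : ℝ)) = y := by
  obtain ⟨π, c, rfl⟩ := hφ
  exact ⟨∑ i, π i * r i, by simp [integralForm, dotProduct]⟩

/-- A rational line meets a transversal rational hyperplane in a rational point. -/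
lemma exists_rat_eq_apply_add_smul (hφ : φ ∈ integralForms p) (hψ : ψ ∈ integralForms p)
    (x r : Fin p → ℚ) {s : ℝ} {y : ℚ} (hx : ψ (fun i => (x i : ℝ)) ≠ y)
    (hs : ψ ((fun i => (x i : ℝ)) + s • fun i => (r i : ℝ)) = y) :
    ∃ y' : ℚ, φ ((fun i => (x i : ℝ)) + s • fun i => (r i : ℝ)) = y' := by
  obtain ⟨φx, hφx⟩ := exists_rat_eq_apply hφ x
  obtain ⟨φr, hφr⟩ := exists_rat_eq_linear hφ r
  obtain ⟨ψx, hψx⟩ := exists_rat_eq_apply hψ x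
  obtain ⟨ψr, hψr⟩ := exists_rat_eq_linear hψ r
  rw [affineMap_add_smul, hψx, hψr] at hs
  have hψr₀ : (ψr : ℝ) ≠ 0 := by
    intro h
    rw [h, mul_zero, add_zero, ← hψx] at hs
    exact hx hs
  have hs' : s = (y - ψx) / ψr := by rw [eq_div_iff hψr₀, ← hs, add_sub_cancel_left]
  exact ⟨φx + (y - ψx) / ψr * φr, by
    rw [affineMap_add_smul, hφx, hφr, hs']
    push_cast
    rfl⟩

lemma exists_pos_smul_sub_smul_mem (hφ : φ ∈ integralForms p) (hψ : ψ ∈ integralForms p) (ρ : ℚ) :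
    ∃ n : ℝ, 0 < n ∧ n • (φ - (ρ : ℝ) • ψ) ∈ integralForms p := by
  refine ⟨ρ.den, by exact_mod_cast ρ.pos, ?_⟩
  have hρ : (ρ.den : ℝ) * ρ = ρ.num := by exact_mod_cast ρ.den_mul_eq_num
  rw [smul_sub, smul_smul, hρ, Nat.cast_smul_eq_nsmul, Int.cast_smul_eq_zsmul]
  exact sub_mem (nsmul_mem hφ _) (zsmul_mem hψ _)

end Rationality

section NormalFrame

/-- The triangle `uvw` in normal form. The integral forms `X` and `Y` serve as coordinates in which
`u = (-a, -1)`, `v = (t a, t)` and `w = (d, -1)`, so that the side `uv` passes through the origin,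
and `(1, 0)` lies strictly beyond the side `vw`. -/
structure IsNormalFrame (X Y : (Fin 2 → ℝ) →ᵃ[ℝ] ℝ) (a d t : ℝ) (u v w : Fin 2 → ℝ) : Prop where
  X_mem : X ∈ integralForms 2
  Y_mem : Y ∈ integralForms 2
  X_u : X u = -a
  Y_u : Y u = -1
  X_v : X v = t * a
  Y_v : Y v = t
  X_w : X w = d
  Y_w : Y w = -1
  a_pos : 0 < a
  t_pos : 0 < t
  base_pos : 0 < d + a
  t_mul_a_lt : t * a < 1
  t_mul_base_lt : t * (d + a) < t + 1

lemma nonneg_of_mem_convexHull_triple {E : Type*} [AddCommGroup E] [Module ℝ E] {φ : E →ᵃ[ℝ] ℝ}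
    {u v w : E} (hu : 0 ≤ φ u) (hv : 0 ≤ φ v) (hw : 0 ≤ φ w) :
    ∀ x ∈ convexHull ℝ {u, v, w}, 0 ≤ φ x := by
  refine convexHull_min ?_ ((convex_Ici 0).affine_preimage φ)
  rintro x (rfl | rfl | rfl)
  exacts [hu, hv, hw]

variable {k : ℕ} {R : Matrix (Fin 2) (Fin k) ℚ} {f : Fin 2 → ℚ} {α : Fin k → ℝ}
  {X Y : (Fin 2 → ℝ) →ᵃ[ℝ] ℝ} {a d t e₀ e₁ e₂ : ℝ} {u v w : Fin 2 → ℝ}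

namespace IsNormalFrame

lemma exists_bound (h : IsNormalFrame X Y a d t u v w)
    (hcone : PointedCone.hull ℝ (Set.range (ray R)) = ⊤) (hα : ∀ i, 0 ≤ α i)
    (hL : inducedSet R f α = convexHull ℝ {u, v, w}) (hu : 0 ≤ e₀ + e₁ * -a + e₂ * -1)
    (hv : 0 ≤ e₀ + e₁ * (t * a) + e₂ * t) (hw : 0 ≤ e₀ + e₁ * d + e₂ * -1)
    (he : e₁ ≠ 0 ∨ e₂ ≠ 0) :
    ∃ ω : ℝ, 0 < ω ∧
      ∀ z ∈ linearRelaxation R f, 1 - ω * (e₀ + e₁ * X z.1 + e₂ * Y z.1) ≤ α ⬝ᵥ z.2 := by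
  let φ : (Fin 2 → ℝ) →ᵃ[ℝ] ℝ := AffineMap.const ℝ _ e₀ + e₁ • X + e₂ • Y
  have hφ (x : Fin 2 → ℝ) : φ x = e₀ + e₁ * X x + e₂ * Y x := rfl
  have hφu : φ u = e₀ + e₁ * -a + e₂ * -1 := by rw [hφ, h.X_u, h.Y_u]
  have hφv : φ v = e₀ + e₁ * (t * a) + e₂ * t := by rw [hφ, h.X_v, h.Y_v]
  have hφw : φ w = e₀ + e₁ * d + e₂ * -1 := by rw [hφ, h.X_w, h.Y_w]
  have hnonneg : ∀ x ∈ inducedSet R f α, 0 ≤ φ x :=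
    hL ▸ nonneg_of_mem_convexHull_triple (hφu ▸ hu) (hφv ▸ hv) (hφw ▸ hw)
  obtain ⟨x, y, hxy⟩ : ∃ x y, φ x ≠ φ y := by
    by_contra! hconst
    have he₁ : e₁ * (d + a) = 0 := by linarith [hconst u w]
    obtain rfl := (mul_eq_zero.1 he₁).resolve_right h.base_pos.ne'
    have he₂ : e₂ * (t + 1) = 0 := by linarith [hconst u v]
    have ht : t + 1 ≠ 0 := by linarith [h.t_pos]
    exact he.elim (fun h₀ => h₀ rfl) fun h₀ => mul_ne_zero h₀ ht he₂
  exact exists_pos_one_sub_mul_le hcone hα hnonneg hxy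

lemma one_le_of_Y_le (h : IsNormalFrame X Y a d t u v w)
    (hcone : PointedCone.hull ℝ (Set.range (ray R)) = ⊤) (hα : ∀ i, 0 ≤ α i)
    (hL : inducedSet R f α = convexHull ℝ {u, v, w}) :
    ∀ z ∈ linearRelaxation R f, Y z.1 ≤ -1 → 1 ≤ α ⬝ᵥ z.2 := by
  obtain ⟨ω, hω, hbound⟩ := h.exists_bound (e₀ := 1) (e₁ := 0) (e₂ := 1) hcone hα hL
    (by linarith) (by linarith [h.t_pos]) (by linarith) (Or.inr one_ne_zero)
  intro z hz hY
  have hle : ω * (1 + 0 * X z.1 + 1 * Y z.1) ≤ 0 :=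
    mul_nonpos_of_nonneg_of_nonpos hω.le (by linarith)
  linarith [hbound z hz]

lemma exists_left_bound (h : IsNormalFrame X Y a d t u v w)
    (hcone : PointedCone.hull ℝ (Set.range (ray R)) = ⊤) (hα : ∀ i, 0 ≤ α i)
    (hL : inducedSet R f α = convexHull ℝ {u, v, w}) :
    ∃ c : ℝ, 0 < c ∧ ∀ z ∈ linearRelaxation R f, 1 - c * (X z.1 - a * Y z.1) ≤ α ⬝ᵥ z.2 := by
  obtain ⟨ω, hω, hbound⟩ := h.exists_bound (e₀ := 0) (e₁ := 1) (e₂ := -a) hcone hα hL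
    (by linarith) (by linarith) (by linarith [h.base_pos]) (Or.inl one_ne_zero)
  exact ⟨ω, hω, fun z hz => by linarith [hbound z hz]⟩

/-- The bound comes from the line through `v = (t a, t)` and `(1, 0)`. -/
lemma exists_apex_bound (h : IsNormalFrame X Y a d t u v w)
    (hcone : PointedCone.hull ℝ (Set.range (ray R)) = ⊤) (hα : ∀ i, 0 ≤ α i)
    (hL : inducedSet R f α = convexHull ℝ {u, v, w}) :
    ∃ B : ℝ, 0 < B ∧ ∀ z ∈ linearRelaxation R f, 1 ≤ X z.1 → 1 + B * Y z.1 ≤ α ⬝ᵥ z.2 := by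
  obtain ⟨ω, hω, hbound⟩ := h.exists_bound (e₀ := t) (e₁ := -t) (e₂ := -(1 - t * a)) hcone hα hL
    (by linarith [h.t_pos]) (by linarith) (by linarith [h.t_mul_base_lt])
    (Or.inl (neg_ne_zero.2 h.t_pos.ne'))
  refine ⟨ω * (1 - t * a), mul_pos hω (sub_pos.2 h.t_mul_a_lt), fun z hz hX => ?_⟩
  have hgap : 0 ≤ ω * t * (X z.1 - 1) :=
    mul_nonneg (mul_pos hω h.t_pos).le (sub_nonneg.2 hX)
  linarith [hbound z hz]

/-- The bound comes from the line through `v = (t a, t)` and `w = (d, -1)`. -/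
lemma exists_right_bound (h : IsNormalFrame X Y a d t u v w)
    (hcone : PointedCone.hull ℝ (Set.range (ray R)) = ⊤) (hα : ∀ i, 0 ≤ α i)
    (hL : inducedSet R f α = convexHull ℝ {u, v, w}) :
    ∃ σ r : ℝ, 0 < σ ∧
      ∀ z ∈ linearRelaxation R f, 1 ≤ X z.1 → 1 + σ + r * Y z.1 ≤ α ⬝ᵥ z.2 := by
  have ht : 0 < 1 + t := by linarith [h.t_pos]
  obtain ⟨ω, hω, hbound⟩ := h.exists_bound (e₀ := t * (d + a)) (e₁ := -(1 + t))
    (e₂ := -(d - t * a)) hcone hα hL (by linarith [mul_pos ht h.base_pos]) (by linarith)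
    (by linarith) (Or.inl (neg_ne_zero.2 ht.ne'))
  refine ⟨ω * (t + 1 - t * (d + a)), ω * (d - t * a), mul_pos hω (sub_pos.2 h.t_mul_base_lt),
    fun z hz hX => ?_⟩
  have hgap : 0 ≤ ω * (1 + t) * (X z.1 - 1) := mul_nonneg (mul_pos hω ht).le (sub_nonneg.2 hX)
  linarith [hbound z hz]

lemma base_nonneg (h : IsNormalFrame X Y a d t u v w) :
    ∀ x ∈ convexHull ℝ {u, v, w}, 0 ≤ (Y + AffineMap.const ℝ (Fin 2 → ℝ) (1 : ℝ)) x := by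
  apply nonneg_of_mem_convexHull_triple <;>
    simp only [AffineMap.coe_add, AffineMap.coe_const, Pi.add_apply, Function.const_apply, h.Y_u,
      h.Y_v, h.Y_w] <;>
    linarith [h.t_pos]

lemma left_nonneg (h : IsNormalFrame X Y a d t u v w) :
    ∀ x ∈ convexHull ℝ {u, v, w}, 0 ≤ (X - a • Y) x := by
  apply nonneg_of_mem_convexHull_triple <;>
    simp only [AffineMap.coe_sub, AffineMap.coe_smul, Pi.sub_apply, Pi.smul_apply, smul_eq_mul,
      h.X_u, h.X_v, h.X_w, h.Y_u, h.Y_v, h.Y_w] <;>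
    linarith [h.base_pos]

/-- The vertex `u` is some `f + r^i / α_i`, the point where a rational line meets the rational line
`Y = -1`. -/
lemma exists_rat (h : IsNormalFrame X Y a d t u v w)
    (hcone : PointedCone.hull ℝ (Set.range (ray R)) = ⊤) (hα : ∀ i, 0 ≤ α i)
    (hL : inducedSet R f α = convexHull ℝ {u, v, w}) : ∃ ρ : ℚ, a = ρ := by
  have hbase : ∀ x ∈ inducedSet R f α, 0 ≤ (Y + AffineMap.const ℝ (Fin 2 → ℝ) (1 : ℝ)) x :=
    hL ▸ h.base_nonneg
  have hleft : ∀ x ∈ inducedSet R f α, 0 ≤ (X - a • Y) x := hL ▸ h.left_nonneg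
  have hu : u ∈ inducedSet R f α := hL ▸ subset_convexHull ℝ _ (Set.mem_insert u _)
  have hu₀ : Y u + 1 + (X u - a * Y u) = 0 := by
    rw [h.X_u, h.Y_u]
    ring
  have hw₀ : Y w + 1 + (X w - a * Y w) ≠ 0 := by
    rw [h.X_w, h.Y_w]
    linarith [h.base_pos]
  have huv : Y u + 1 ≠ Y v + 1 := by
    rw [h.Y_u, h.Y_v]
    linarith [h.t_pos]
  have hf : 0 < Y (realPoint f) + 1 := pos_realPoint hcone hα hbase huv
  obtain ⟨i, hi, hs⟩ := exists_generator_eq_zero hcone hα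
    (φ := Y + AffineMap.const ℝ _ 1 + (X - a • Y))
    (fun x hx => add_nonneg (hbase x hx) (hleft x hx)) hu hu₀ hw₀
  have hsL := realPoint_add_inv_smul_ray_mem_inducedSet (R := R) (f := f) hi
  obtain ⟨hYs : Y _ + 1 = 0, hXs : X _ - a * Y _ = 0⟩ :=
    (add_eq_zero_iff_of_nonneg (hbase _ hsL) (hleft _ hsL)).1 hs
  rw [add_eq_zero_iff_eq_neg] at hYs
  rw [hYs, mul_neg_one, sub_neg_eq_add, ← eq_neg_iff_add_eq_zero] at hXs
  have hfY : Y (fun j => (f j : ℝ)) ≠ (-1 : ℚ) := by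
    push_cast
    exact fun hY => hf.ne' (add_eq_zero_iff_eq_neg.2 hY)
  obtain ⟨ρ, hρ⟩ := exists_rat_eq_apply_add_smul h.X_mem h.Y_mem f (fun j => R j i) hfY
    (by exact_mod_cast hYs)
  exact ⟨-ρ, by
    push_cast
    linarith [hXs.symm.trans hρ]⟩

end IsNormalFrame

end NormalFrame

section IntegerPlane

/-- The inclusion of `ℤ²` in the plane. -/
def intPoint : (Fin 2 → ℤ) →+ (Fin 2 → ℝ) :=
  (Int.castAddHom ℝ).compLeft (Fin 2)

@[simp]
lemma intPoint_apply (z : Fin 2 → ℤ) (i : Fin 2) : intPoint z i = z i :=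
  rfl

lemma intPoint_injective : Function.Injective intPoint := fun _ _ h =>
  funext fun i => Int.cast_injective (congrFun h i)

lemma intPoint_zsmul (n : ℤ) (z : Fin 2 → ℤ) : intPoint (n • z) = (n : ℝ) • intPoint z := by
  rw [map_zsmul, Int.cast_smul_eq_zsmul]

lemma intPoint_mem_latticePoints (z : Fin 2 → ℤ) : intPoint z ∈ latticePoints :=
  ⟨z, fun _ => rfl⟩

lemma exists_intPoint_eq {x : Fin 2 → ℝ} (hx : x ∈ latticePoints) : ∃ z, intPoint z = x := by
  obtain ⟨z, hz⟩ := hx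
  exact ⟨z, (funext hz).symm⟩

variable {D b : Fin 2 → ℤ}

lemma exists_eq_zsmul_of_det_eq_zero (hD : IsCoprime (D 0) (D 1))
    (h : D 0 * b 1 - D 1 * b 0 = 0) : ∃ r : ℤ, b = r • D := by
  obtain ⟨x, y, hxy⟩ := hD
  refine ⟨x * b 0 + y * b 1, funext fun i => ?_⟩
  fin_cases i <;> simp only [Fin.zero_eta, Fin.mk_one, Pi.smul_apply, smul_eq_mul] <;> grind

lemma exists_isCoprime_zsmul_eq (hb : b ≠ 0) :
    ∃ (g : ℤ) (D : Fin 2 → ℤ), 1 ≤ g ∧ IsCoprime (D 0) (D 1) ∧ b = g • D := by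
  have hpos : 0 < Int.gcd (b 0) (b 1) := by
    rw [Int.gcd_pos_iff]
    by_contra! h₀
    exact hb (funext (Fin.forall_fin_two.2 h₀))
  obtain ⟨x, y, hxy, hx, hy⟩ := Int.exists_gcd_one hpos
  refine ⟨Int.gcd (b 0) (b 1), ![x, y], by exact_mod_cast hpos, Int.isCoprime_iff_gcd_eq_one.2 hxy,
    funext (Fin.forall_fin_two.2 ⟨?_, ?_⟩)⟩
  · exact hx.trans (mul_comm _ _)
  · exact hy.trans (mul_comm _ _)

/-- If `|det(D, b)| > 1`, the lattice spanned by `D` and `b` misses integer vectors, and one of them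
lies in the triangle with vertices `0`, `D` and `b`. -/
lemma isUnit_det_of_forall_zsmul_eq (hD : IsCoprime (D 0) (D 1))
    (hdet : D 0 * b 1 - D 1 * b 0 ≠ 0)
    (hempty : ∀ (x : Fin 2 → ℤ) (m r : ℤ), 0 ≤ r → r < m → m • x = b + r • D → x = b) :
    IsUnit (D 0 * b 1 - D 1 * b 0) := by
  obtain ⟨x, y, hxy⟩ := hD
  set h := D 0 * b 1 - D 1 * b 0
  set c := x * b 0 + y * b 1
  have hb₀ : b 0 = c * D 0 - h * y := by linear_combination (-b 0) * hxy
  have hb₁ : b 1 = c * D 1 + h * x := by linear_combination (-b 1) * hxy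
  have hm : 0 < |h| := abs_pos.2 hdet
  have hr : |h| * (-c / |h|) + -c % |h| = -c := Int.mul_ediv_add_emod _ _
  have hsign : |h| * h.sign = h := by rw [mul_comm, Int.sign_mul_abs]
  have hlift : |h| • (h.sign • ![-y, x] - (-c / |h|) • D) = b + (-c % |h|) • D := by
    refine funext (Fin.forall_fin_two.2 ⟨?_, ?_⟩) <;>
      simp only [Pi.smul_apply, Pi.sub_apply, Pi.add_apply, smul_eq_mul, Matrix.cons_val_zero,
        Matrix.cons_val_one]
    · linear_combination -y * hsign - D 0 * hr - hb₀
    · linear_combination x * hsign - D 1 * hr - hb₁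
  have hmb := hempty _ _ _ (Int.emod_nonneg _ hm.ne') (Int.emod_lt_of_pos _ hm) hlift ▸ hlift
  have hzero : (|h| - 1) * h = 0 := by
    have h₀ := congrFun hmb 0
    have h₁ := congrFun hmb 1
    simp only [Pi.smul_apply, Pi.add_apply, smul_eq_mul] at h₀ h₁
    linear_combination D 0 * h₁ - D 1 * h₀
  exact Int.isUnit_iff_abs_eq.2 (sub_eq_zero.1 ((mul_eq_zero.1 hzero).resolve_right hdet))

lemma exists_integralForms_of_isUnit_det (hdet : IsUnit (D 0 * b 1 - D 1 * b 0)) (q : Fin 2 → ℤ)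
    (j : ℤ) :
    ∃ X ∈ integralForms 2, ∃ Y ∈ integralForms 2, X (intPoint q) = 0 ∧ Y (intPoint q) = 0 ∧
      X.linear (intPoint b) = -j ∧ Y.linear (intPoint b) = 1 ∧
      X.linear (intPoint D) = 1 ∧ Y.linear (intPoint D) = 0 := by
  set δ := D 0 * b 1 - D 1 * b 0 with hδ
  have hδδ : (δ : ℝ) * δ = 1 := by exact_mod_cast Int.isUnit_mul_self hdet
  have hδR : (δ : ℝ) = D 0 * b 1 - D 1 * b 0 := by exact_mod_cast hδ
  have hlinear (x y c : ℤ) (z : Fin 2 → ℤ) :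
      (integralForm ![x, y] c).linear (intPoint z) = x * z 0 + y * z 1 := by
    simp [integralForm, dotProduct]
  have hzero (π : Fin 2 → ℤ) : integralForm π (-(π ⬝ᵥ q)) (intPoint q) = 0 := by
    simp [dotProduct]
  refine ⟨_, integralForm_mem ![δ * (b 1 + j * D 1), -(δ * (b 0 + j * D 0))] _, _,
    integralForm_mem ![-(δ * D 1), δ * D 0] _, hzero _, hzero _, ?_⟩
  simp only [hlinear]
  push_cast
  refine ⟨?_, ?_, ?_, ?_⟩
  · linear_combination (-j : ℝ) * hδδ + j * δ * hδR
  · linear_combination hδδ - δ * hδR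
  · linear_combination hδδ - δ * hδR
  · ring

end IntegerPlane

section PrimitiveTriangle

/-- The arithmetic of a triangle `uvw` of type `T^{2B}`: `D` is the primitive direction of the side
`uw`, which contains the integer points `P` and `P + D`, and `q` is the only integer point of the
triangle that does not lie on the line `uw`. It lies in the relative interior of `uv`. -/
structure IsPrimitiveTriangle (u v w : Fin 2 → ℝ) (q P D : Fin 2 → ℤ) (l μ t : ℝ) : Prop where
  isCoprime : IsCoprime (D 0) (D 1)
  w_eq : w = u + l • intPoint D
  P_eq : intPoint P = u + μ • intPoint D
  v_eq : v = intPoint q + t • (intPoint q - u)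
  μ_nonneg : 0 ≤ μ
  μ_add_one_le : μ + 1 ≤ l
  t_pos : 0 < t
  q_ne : ∀ s : ℝ, intPoint q ≠ u + s • intPoint D
  eq_q : ∀ z, intPoint z ∈ convexHull ℝ {u, v, w} → (∀ s : ℝ, intPoint z ≠ u + s • intPoint D) →
    z = q

lemma add_smul_sub_add_smul_sub_mem {E : Type*} [AddCommGroup E] [Module ℝ E] {S : Set E}
    (hS : Convex ℝ S) {x y z : E} (hx : x ∈ S) (hy : y ∈ S) (hz : z ∈ S) {a b : ℝ} (ha : 0 ≤ a)
    (hb : 0 ≤ b) (hab : a + b ≤ 1) : x + a • (y - x) + b • (z - x) ∈ S := by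
  have hsum := hS.sum_mem (t := Finset.univ) (w := ![1 - a - b, a, b]) (z := ![x, y, z])
    (by simpa [Fin.forall_fin_succ, ha, hb] using le_sub_iff_add_le'.2 hab)
    (by simp only [Fin.sum_univ_three, Matrix.cons_val]; ring)
    (by simp [Fin.forall_fin_succ, hx, hy, hz])
  convert hsum using 1
  simp only [Fin.sum_univ_three, Matrix.cons_val]
  module

namespace IsPrimitiveTriangle

variable {u v w : Fin 2 → ℝ} {q P D : Fin 2 → ℤ} {l μ t : ℝ}

lemma l_pos (h : IsPrimitiveTriangle u v w q P D l μ t) : 0 < l := by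
  linarith [h.μ_nonneg, h.μ_add_one_le]

lemma eq_q_of_intPoint_eq (h : IsPrimitiveTriangle u v w q P D l μ t) {z : Fin 2 → ℤ} {ρ s : ℝ}
    (hρ : 0 < ρ) (hs : 0 ≤ s) (hle : ρ * l + s * (1 + t) ≤ (1 + t) * l)
    (hz : intPoint z = u + ρ • (intPoint q - u) + s • intPoint D) : z = q := by
  have ht : 0 < 1 + t := by linarith [h.t_pos]
  refine h.eq_q z ?_ fun s' hs' => h.q_ne ((s' - s) / ρ) ?_
  · have hv : v - u = (1 + t) • (intPoint q - u) := by
      rw [h.v_eq]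
      module
    have hw : w - u = l • intPoint D := by rw [h.w_eq, add_sub_cancel_left]
    have hmem := add_smul_sub_add_smul_sub_mem (convex_convexHull ℝ {u, v, w})
      (subset_convexHull ℝ _ (by simp) : u ∈ _) (subset_convexHull ℝ _ (by simp) : v ∈ _)
      (subset_convexHull ℝ _ (by simp) : w ∈ _) (div_nonneg hρ.le ht.le)
      (div_nonneg hs h.l_pos.le) (by
        rwa [div_add_div _ _ ht.ne' h.l_pos.ne', div_le_one (mul_pos ht h.l_pos), mul_comm _ s])
    rwa [hv, hw, smul_smul, smul_smul, div_mul_cancel₀ _ ht.ne', div_mul_cancel₀ _ h.l_pos.ne',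
      ← hz] at hmem
  · have hqu : ρ • (intPoint q - u) = (s' - s) • intPoint D := by
      rw [sub_smul, eq_sub_iff_add_eq, ← add_right_inj u, ← add_assoc, ← hz, hs']
    rw [div_eq_inv_mul, mul_smul, ← hqu, inv_smul_smul₀ hρ.ne', add_sub_cancel]

lemma det_ne_zero (h : IsPrimitiveTriangle u v w q P D l μ t) :
    D 0 * (q - P) 1 - D 1 * (q - P) 0 ≠ 0 := by
  intro h₀
  obtain ⟨r, hr⟩ := exists_eq_zsmul_of_det_eq_zero h.isCoprime h₀
  refine h.q_ne (μ + r) ?_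
  rw [← sub_add_cancel q P, hr, map_add, intPoint_zsmul, h.P_eq]
  module

lemma isUnit_det (h : IsPrimitiveTriangle u v w q P D l μ t) :
    IsUnit (D 0 * (q - P) 1 - D 1 * (q - P) 0) := by
  refine isUnit_det_of_forall_zsmul_eq h.isCoprime h.det_ne_zero fun x m r hr hrm hx => ?_
  have hm : (0 : ℝ) < m := by exact_mod_cast hr.trans_lt hrm
  have hrm' : (r : ℝ) ≤ m - 1 := by exact_mod_cast Int.le_sub_one_of_lt hrm
  have hr' : (0 : ℝ) ≤ r := by exact_mod_cast hr
  have hxR : intPoint x = (m : ℝ)⁻¹ • (intPoint q - intPoint P + (r : ℝ) • intPoint D) := by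
    rw [eq_inv_smul_iff₀ hm.ne', ← intPoint_zsmul, hx, map_add, map_sub, intPoint_zsmul]
  have hs : 0 ≤ μ * (m - 1) + r := by
    have := mul_nonneg h.μ_nonneg (hr'.trans hrm')
    linarith
  have hle : μ * (m - 1) + r ≤ l * (m - 1) := by
    linarith [mul_le_mul_of_nonneg_right h.μ_add_one_le (hr'.trans hrm')]
  have hPx : P + x = q := by
    refine h.eq_q_of_intPoint_eq (inv_pos.2 hm) (mul_nonneg (inv_pos.2 hm).le hs) ?_ ?_
    · refine le_of_mul_le_mul_left ?_ hm
      rw [mul_add, ← mul_assoc, ← mul_assoc, ← mul_assoc, mul_inv_cancel₀ hm.ne']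
      have ht := h.t_pos
      linarith [mul_le_mul_of_nonneg_right hle (by linarith : 0 ≤ 1 + t), mul_pos ht h.l_pos]
    · have hmm : (m : ℝ)⁻¹ * (m - 1) = 1 - (m : ℝ)⁻¹ := by
        rw [mul_sub, inv_mul_cancel₀ hm.ne', mul_one]
      rw [map_add, hxR, h.P_eq]
      have hcoeff : (m : ℝ)⁻¹ * (μ * (m - 1) + r) = μ * (1 - (m : ℝ)⁻¹) + (m : ℝ)⁻¹ * r := by
        rw [← hmm]
        ring
      rw [hcoeff]
      module
  rw [← hPx, add_sub_cancel_left]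

lemma t_mul_l_lt (h : IsPrimitiveTriangle u v w q P D l μ t) : t * l < t + 1 := by
  by_contra! hle
  have hq : q + D = q := by
    refine h.eq_q_of_intPoint_eq one_pos zero_le_one (by linarith) ?_
    rw [map_add]
    module
  have hD : D = 0 := add_eq_left.1 hq
  exact not_isCoprime_zero_zero (by simpa [hD] using h.isCoprime)

lemma t_lt_one (h : IsPrimitiveTriangle u v w q P D l μ t) {z : Fin 2 → ℤ} (hz : intPoint z = u) :
    t < 1 := by
  by_contra! hle
  have hq : 2 • q - z = q := by
    refine h.eq_q_of_intPoint_eq two_pos le_rfl ?_ ?_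
    · linarith [mul_le_mul_of_nonneg_right hle h.l_pos.le]
    · rw [map_sub, map_nsmul, hz]
      module
  rw [two_nsmul, add_sub_assoc, add_eq_left, sub_eq_zero] at hq
  exact h.q_ne 0 (by rw [hq, hz, zero_smul, add_zero])

lemma t_mul_sub_lt_one (h : IsPrimitiveTriangle u v w q P D l μ t) {j : ℤ}
    (hj : μ ≤ j + 1) : t * (μ - j) < 1 := by
  rcases hj.eq_or_lt with hμ | hμ
  · have hu : intPoint (P - (j + 1) • D) = u := by
      rw [map_sub, intPoint_zsmul, h.P_eq, hμ]
      push_cast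
      module
    rw [hμ, add_sub_cancel_left, mul_one]
    exact h.t_lt_one hu
  · have hj₀ : (0 : ℝ) ≤ j := by
      have : (-1 : ℝ) < j := by linarith [h.μ_nonneg]
      exact_mod_cast Int.add_one_le_iff.2 (by exact_mod_cast this : (-1 : ℤ) < j)
    have hl : 1 + (μ - j) ≤ l := by linarith [h.μ_add_one_le]
    linarith [h.t_mul_l_lt, mul_le_mul_of_nonneg_left hl h.t_pos.le]

lemma exists_isNormalFrame (h : IsPrimitiveTriangle u v w q P D l μ t) :
    ∃ X Y a d t, IsNormalFrame X Y a d t u v w := by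
  obtain ⟨j, hj, hj'⟩ : ∃ j : ℤ, j < μ ∧ μ ≤ j + 1 :=
    ⟨⌈μ⌉ - 1, by exact_mod_cast sub_lt_iff_lt_add.2 (Int.ceil_lt_add_one μ),
      by simpa using Int.le_ceil μ⟩
  obtain ⟨X, hX, Y, hY, hXq, hYq, hXb, hYb, hXD, hYD⟩ :=
    exists_integralForms_of_isUnit_det h.isUnit_det q j
  have hqu : intPoint q - u = intPoint (q - P) + μ • intPoint D := by
    rw [map_sub, h.P_eq]
    module
  have hu : u = intPoint q + (-1 : ℝ) • (intPoint q - u) := by module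
  have hXqu : X.linear (intPoint q - u) = μ - j := by
    rw [hqu, map_add, map_smul, hXb, hXD, smul_eq_mul]
    ring
  have hYqu : Y.linear (intPoint q - u) = 1 := by
    rw [hqu, map_add, map_smul, hYb, hYD, smul_zero, add_zero]
  have hXu : X u = -(μ - j) := by rw [hu, affineMap_add_smul, hXqu, hXq]; ring
  have hYu : Y u = -1 := by rw [hu, affineMap_add_smul, hYqu, hYq]; ring
  exact ⟨X, Y, μ - j, l - (μ - j), t, {
    X_mem := hX
    Y_mem := hY
    X_u := hXu
    Y_u := hYu
    X_v := by rw [h.v_eq, affineMap_add_smul, hXqu, hXq, zero_add]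
    Y_v := by rw [h.v_eq, affineMap_add_smul, hYqu, hYq, zero_add, mul_one]
    X_w := by rw [h.w_eq, affineMap_add_smul, hXD, hXu]; ring
    Y_w := by rw [h.w_eq, affineMap_add_smul, hYD, hYu, mul_zero, add_zero]
    a_pos := sub_pos.2 hj
    t_pos := h.t_pos
    base_pos := by linarith [h.l_pos]
    t_mul_a_lt := h.t_mul_sub_lt_one hj'
    t_mul_base_lt := by rw [sub_add_cancel]; exact h.t_mul_l_lt }⟩

end IsPrimitiveTriangle

end PrimitiveTriangle

section TypeT2B

lemma mem_segment_of_mem_convexHull_of_notMem_interior {E : Type*} [NormedAddCommGroup E]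
    [NormedSpace ℝ E] (hE : Module.finrank ℝ E = 2) {u v w x : E}
    (hind : AffineIndependent ℝ ![u, v, w]) (hx : x ∈ convexHull ℝ {u, v, w})
    (hint : x ∉ interior (convexHull ℝ {u, v, w})) :
    x ∈ segment ℝ u v ∨ x ∈ segment ℝ v w ∨ x ∈ segment ℝ u w := by
  have : FiniteDimensional ℝ E := .of_finrank_pos (hE ▸ two_pos)
  let b : AffineBasis (Fin 3) ℝ E :=
    ⟨![u, v, w], hind, hind.affineSpan_eq_top_iff_card_eq_finrank_add_one.2 (by simp [hE])⟩
  have hrange : Set.range b = {u, v, w} := by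
    change Set.range ![u, v, w] = _
    simp only [Matrix.range_cons, Matrix.range_empty, Set.union_empty, Set.singleton_union]
  rw [← hrange, b.interior_convexHull] at hint
  rw [← hrange, b.convexHull_eq_nonneg_coord] at hx
  obtain ⟨i, hi⟩ : ∃ i, b.coord i x = 0 := by
    by_contra! hne
    exact hint fun i => (hx i).lt_of_ne' (hne i)
  have hsum := b.sum_coord_apply_eq_one x
  have hcomb : ∑ i, b.coord i x • ![u, v, w] i = x := b.linear_combination_coord_eq_self x
  simp only [Fin.sum_univ_three, Matrix.cons_val] at hsum hcomb
  fin_cases i <;> simp only [Fin.zero_eta, Fin.mk_one, Fin.reduceFinMk] at hi <;>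
    simp only [hi, zero_smul, zero_add, add_zero] at hsum hcomb
  · exact Or.inr (Or.inl ⟨_, _, hx 1, hx 2, hsum, hcomb⟩)
  · exact Or.inr (Or.inr ⟨_, _, hx 0, hx 2, hsum, hcomb⟩)
  · exact Or.inl ⟨_, _, hx 0, hx 1, hsum, hcomb⟩

variable {u v w : Fin 2 → ℝ}

lemma mem_segment_or_mem_openSegment_of_isLatticeFree (hind : AffineIndependent ℝ ![u, v, w])
    (hfree : IsLatticeFree (convexHull ℝ {u, v, w})) (hv : v ∉ latticePoints)
    (hvw : openSegment ℝ v w ∩ latticePoints = ∅) {x : Fin 2 → ℝ} (hx : x ∈ latticePoints)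
    (hxL : x ∈ convexHull ℝ {u, v, w}) : x ∈ segment ℝ u w ∨ x ∈ openSegment ℝ u v := by
  have hint : x ∉ interior (convexHull ℝ {u, v, w}) := fun h =>
    Set.eq_empty_iff_forall_notMem.1 hfree x ⟨h, hx⟩
  have hxv : x ≠ v := fun h => hv (h ▸ hx)
  rcases mem_segment_of_mem_convexHull_of_notMem_interior (by simp) hind hxL hint with h | h | h
  · rw [← insert_endpoints_openSegment] at h
    rcases h with rfl | h | h
    exacts [Or.inl (left_mem_segment ℝ _ _), absurd h hxv, Or.inr h]
  · rw [← insert_endpoints_openSegment] at h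
    rcases h with h | rfl | h
    exacts [absurd h hxv, Or.inl (right_mem_segment ℝ _ _),
      absurd ⟨h, hx⟩ (Set.eq_empty_iff_forall_notMem.1 hvw x)]
  · exact Or.inl h

lemma exists_primitive_direction (h : (segment ℝ u w ∩ latticePoints).Nontrivial) :
    ∃ (P D : Fin 2 → ℤ) (l μ : ℝ), IsCoprime (D 0) (D 1) ∧ w = u + l • intPoint D ∧
      intPoint P = u + μ • intPoint D ∧ 0 ≤ μ ∧ μ + 1 ≤ l := by
  obtain ⟨x, ⟨hx, hxZ⟩, y, ⟨hy, hyZ⟩, hxy⟩ := h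
  rw [segment_eq_image'] at hx hy
  obtain ⟨θ, hθ, rfl⟩ := hx
  obtain ⟨θ', hθ', rfl⟩ := hy
  wlog hlt : θ < θ' generalizing θ θ'
  · exact this θ' hθ' hyZ θ hθ hxZ hxy.symm (lt_of_le_of_ne (not_lt.1 hlt) fun h =>
      hxy (by rw [h]))
  obtain ⟨P, hP⟩ := exists_intPoint_eq hxZ
  obtain ⟨P', hP'⟩ := exists_intPoint_eq hyZ
  obtain ⟨g, D, hg, hD, hgD⟩ := exists_isCoprime_zsmul_eq (b := P' - P)
    (sub_ne_zero.2 fun h => hxy (by rw [← hP, ← hP', h]))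
  have hgap : θ' - θ ≠ 0 := (sub_pos.2 hlt).ne'
  have hdir : (g : ℝ) • intPoint D = (θ' - θ) • (w - u) := by
    rw [← intPoint_zsmul, ← hgD, map_sub, hP, hP']
    module
  have hw : w - u = (g / (θ' - θ)) • intPoint D := by
    rw [div_eq_inv_mul, mul_smul, hdir, inv_smul_smul₀ hgap]
  have hgR : (1 : ℝ) ≤ g := by exact_mod_cast hg
  have hl : 0 ≤ g / (θ' - θ) := div_nonneg (by linarith) (sub_pos.2 hlt).le
  have hgl : (θ' - θ) * (g / (θ' - θ)) = g := mul_div_cancel₀ _ hgap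
  refine ⟨P, D, g / (θ' - θ), θ * (g / (θ' - θ)), hD, ?_, ?_, mul_nonneg hθ.1 hl, ?_⟩
  · rw [← hw, add_sub_cancel]
  · rw [mul_smul, ← hw, hP]
  · linarith [mul_le_mul_of_nonneg_right hθ'.2 hl]

lemma exists_eq_add_smul_sub_of_mem_openSegment {E : Type*} [AddCommGroup E] [Module ℝ E]
    {u v x : E} (hx : x ∈ openSegment ℝ u v) : ∃ t : ℝ, 0 < t ∧ v = x + t • (x - u) := by
  obtain ⟨a, b, ha, hb, hab, rfl⟩ := hx
  refine ⟨a / b, div_pos ha hb, (smul_right_injective E hb.ne').eq_iff.1 ?_⟩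
  obtain rfl : a = 1 - b := eq_sub_of_add_eq hab
  rw [smul_add, smul_smul, mul_div_cancel₀ _ hb.ne']
  module

lemma ne_add_smul_of_affineIndependent {E : Type*} [AddCommGroup E] [Module ℝ E] {u v w x d : E}
    {l t s : ℝ} (hind : AffineIndependent ℝ ![u, v, w]) (hw : w = u + l • d)
    (hv : v = x + t • (x - u)) : x ≠ u + s • d := by
  rintro rfl
  refine affineIndependent_iff_not_collinear_set.1 hind
    ((collinear_iff_of_mem (Set.mem_insert u _)).2 ⟨d, ?_⟩)
  rintro _ (rfl | rfl | rfl)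
  · exact ⟨0, by simp⟩
  · exact ⟨s + t * s, by rw [hv, vadd_eq_add]; module⟩
  · exact ⟨l, by rw [hw, vadd_eq_add, add_comm]⟩

lemma IsTypeT2B.exists_isPrimitiveTriangle {L : Set (Fin 2 → ℝ)} (hL : IsTypeT2B L) :
    ∃ u v w q P D l μ t, L = convexHull ℝ {u, v, w} ∧ IsPrimitiveTriangle u v w q P D l μ t := by
  obtain ⟨u, v, w, hind, rfl, hfree, hv, huw, ⟨x, ⟨hxuv, hxZ⟩, hunique⟩, hvw⟩ := hL
  obtain ⟨q, rfl⟩ := exists_intPoint_eq hxZ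
  obtain ⟨P, D, l, μ, hD, hw, hP, hμ, hμl⟩ := exists_primitive_direction huw
  obtain ⟨t, ht, hvq⟩ := exists_eq_add_smul_sub_of_mem_openSegment hxuv
  refine ⟨u, v, w, q, P, D, l, μ, t, rfl, hD, hw, hP, hvq, hμ, hμl, ht,
    fun s => ne_add_smul_of_affineIndependent hind hw hvq, fun z hz hline => ?_⟩
  have hzZ := intPoint_mem_latticePoints z
  rcases mem_segment_or_mem_openSegment_of_isLatticeFree hind hfree hv hvw hzZ hz with huw | huv
  · rw [segment_eq_image'] at huw
    obtain ⟨θ, -, hθ⟩ := huw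
    refine absurd ?_ (hline (θ * l))
    rw [← hθ, hw, add_sub_cancel_left, mul_smul]
  · exact intPoint_injective (hunique _ ⟨huv, hzZ⟩)

end TypeT2B

/-- The inequality `∑ α_i s_i ≥ 1` is written as `0ᵀ x + (-α)ᵀ s ≤ -1`. -/
theorem mainTheorem2 (k : ℕ) (R : Matrix (Fin 2) (Fin k) ℚ) (f : Fin 2 → ℚ) (α : Fin k → ℝ)
    (hf : realPoint f ∉ latticePoints)
    (hR : ∀ i, ray R i ≠ 0)
    (hcone : PointedCone.hull ℝ (Set.range (ray R)) = ⊤)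
    (hα : ∀ i, 0 ≤ α i)
    (hvalid : IsValidIneq 0 (-α) (-1) (convexHull ℝ (mixedIntegerSet R f)))
    (hL : IsTypeT2B (inducedSet R f α)) :
    splitRank (linearRelaxation R f) 0 (-α) (-1) < ⊤ := by
  obtain ⟨u, v, w, _, _, _, _, _, _, hhull, htriangle⟩ := hL.exists_isPrimitiveTriangle
  obtain ⟨X, Y, a, d, t, hframe⟩ := htriangle.exists_isNormalFrame
  obtain ⟨ρ, rfl⟩ := hframe.exists_rat hcone hα hhull
  obtain ⟨n, hn, hXY⟩ := exists_pos_smul_sub_smul_mem hframe.X_mem hframe.Y_mem ρ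
  obtain ⟨c, hc, hleft⟩ := hframe.exists_left_bound hcone hα hhull
  obtain ⟨B, hB, hapex⟩ := hframe.exists_apex_bound hcone hα hhull
  obtain ⟨σ, r, hσ, hright⟩ := hframe.exists_right_bound hcone hα hhull
  have hbase := hframe.one_le_of_Y_le hcone hα hhull
  have hnonneg : ∀ z ∈ linearRelaxation R f, 0 ≤ α ⬝ᵥ z.2 := fun z hz =>
    Finset.sum_nonneg fun i _ => mul_nonneg (hα i) (hz.2 i)
  obtain ⟨N, hN⟩ := exists_iterSplitClosure_one_le_dotProduct hframe.X_mem hframe.Y_mem hXY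
    hframe.a_pos hn hc hB hσ (convex_linearRelaxation R f) hnonneg hbase hleft hapex hright
  refine splitRank_lt_top (n := N) fun z hz => ?_
  rw [zero_dotProduct, neg_dotProduct, zero_add]
  exact neg_le_neg (hN z hz)
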